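/- Let $(h_i)_{i\ge1}$, $(m_i)_{i\ge1}$ be real sequences and let $(p_i)_{i\ge 1}$, $(q_i)_{i\ge1}$, $(r_i)_{i\ge1}$ be sequences of non-zero real numbers. Consider the infinite-dimensional diagonal one-step filtering model $$v_{1,i}=m_i v_{0,i}+\xi_i,\qquad y_i=h_i v_{1,i}+\zeta_i,\qquad i\ge 1,$$ where $v_{0,i}\sim\mathcal N(0,p_i^2)$, $\xi_i\sim\mathcal N(0,q_i^2)$, $\zeta_i\sim\mathcal N(0,r_i^2)$ are all independent. For sequences $(a_i)$, $(\gamma_i^2)$, $(\sigma_i^2)$ and data $y=(y_i)$, the inverse problem $y_i=a_iu_i+\eta_i$, $\eta_i\sim\mathcal N(0,\gamma_i^2)$, $u_i\sim\mathcal N(0,\sigma_i^2)$ has prior $\pi^{(1:\infty)}=\prod_i\mathcal N(0,\sigma_i^2)$ and posterior $\mu^{(1:\infty)}=\prod_i\mu_i$, where $\mu_i$ is the probability measure proportional to $\exp\bigl(-\tfrac{(y_i-a_iu)^2}{2\gamma_i^2}\bigr)\,\mathcal N(0,\sigma_i^2)(du)$. The standard proposal $\pi_{\rm std}^{(1:\infty)}$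 and its target $\mu_{\rm std}^{(1:\infty)}$ are the prior and the posterior for $a_i=h_i$, $\gamma_i^2=r_i^2$, $\sigma_i^2=m_i^2p_i^2+q_i^2$. The optimal proposal $\pi_{\rm opt}^{(1:\infty)}$ and its target $\mu_{\rm opt}^{(1:\infty)}$ are the prior and the posterior for $a_i=h_im_i$, $\gamma_i^2=h_i^2q_i^2+r_i^2$, $\sigma_i^2=p_i^2$. Write $\rho_{\rm std}=d_{\chi^2}(\mu_{\rm std}^{(1:\infty)}\,\|\,\pi_{\rm std}^{(1:\infty)})+1$ and $\rho_{\rm opt}=d_{\chi^2}(\mu_{\rm opt}^{(1:\infty)}\,\|\,\pi_{\rm opt}^{(1:\infty)})+1$, where $d_{\chi^2}(\mu\|\pi)=\int (d\mu/d\pi)^2\,d\pi-1$ if $\mu\ll\pi$ and $d_{\chi^2}(\mu\|\pi)=\infty$ otherwise. Then, for almost every $y$ with respect to the law of the data in the filtering model: 1. $\mu_{\rm opt}^{(1:\infty)}\ll\pi_{\rm opt}^{(1:\infty)}$ and $\rho_{\rm opt}<\infty$ if and only if $\sum_{i=1}^\infty\frac{h_i^2m_i^2p_i^2}{h_i^2q_i^2+r_i^2}<\infty$;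 moreover $\mu_{\rm opt}^{(1:\infty)}\ll\pi_{\rm opt}^{(1:\infty)}$ alone holds if and only if this sum is finite. 2. $\mu_{\rm std}^{(1:\infty)}\ll\pi_{\rm std}^{(1:\infty)}$ and $\rho_{\rm std}<\infty$ if and only if $\sum_{i=1}^\infty\frac{h_i^2m_i^2p_i^2}{r_i^2}<\infty$ and $\sum_{i=1}^\infty\frac{h_i^2q_i^2}{r_i^2}<\infty$; moreover $\mu_{\rm std}^{(1:\infty)}\ll\pi_{\rm std}^{(1:\infty)}$ alone holds if and only if both sums are finite. -/

import Mathlib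

open MeasureTheory ProbabilityTheory
open scoped ENNReal NNReal

noncomputable section

namespace DiagonalFiltering

/-- The `χ²`-divergence `d_χ²(μ ‖ π) = π(g²) / π(g)² - 1`, computed with the normalized density
`g = dμ/dπ` (so that `π(g) = 1` for a probability measure `μ`);
as usual it is `∞` when `μ` is not absolutely continuous with respect to `π`. -/
def chiSqDiv {X : Type*} [MeasurableSpace X] (μ π : Measure X) : ℝ≥0∞ :=
  open Classical in if μ ≪ π then (∫⁻ x, (μ.rnDeriv π x) ^ 2 ∂π) - 1 else ∞

/-- `ρ = d_χ²(μ ‖ π) + 1`. -/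
def rho {X : Type*} [MeasurableSpace X] (μ π : Measure X) : ℝ≥0∞ :=
  chiSqDiv μ π + 1

/-- An infinite-dimensional diagonal linear-Gaussian inverse problem
`y_i = a_i u_i + η_i`, `η_i ∼ N(0, γ_i²)`, `u_i ∼ N(0, σ_i²)`, independently over `i`.
The fields are the design `a_i`, the noise variances `γ_i²` and the prior variances `σ_i²`. -/
structure InverseProblem where
  /-- the diagonal entries `a_i` of the design matrix -/
  design : ℕ → ℝ
  /-- the noise variances `γ_i²` -/
  noiseVar : ℕ → ℝ
  /-- the prior variances `σ_i²` -/
  priorVar : ℕ → ℝ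

/-- Bayes' rule for the scalar problem `y = a u + η`, `η ∼ N(0, γ²)`, `u ∼ N(0, σ²)`, with
`γsq = γ²` and `σsq = σ²`: the posterior is the probability measure proportional to
`exp (-(y - a u)² / (2 γ²)) N(0, σ²)(du)`. -/
def scalarPosterior (a γsq σsq y : ℝ) : Measure ℝ :=
  (gaussianReal 0 σsq.toNNReal).tilted (fun u => -(y - a * u) ^ 2 / (2 * γsq))

/-- The scalar posterior is a probability measure. -/
theorem isProbabilityMeasure_scalarPosterior (a σsq y : ℝ) {γsq : ℝ} (h : 0 ≤ γsq) :
    IsProbabilityMeasure (scalarPosterior a γsq σsq y) := by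
  refine isProbabilityMeasure_tilted ?_
  refine Integrable.of_bound (by fun_prop) 1 (ae_of_all _ fun u => ?_)
  rw [Real.norm_eq_abs, Real.abs_exp, Real.exp_le_one_iff]
  exact div_nonpos_of_nonpos_of_nonneg (by nlinarith [sq_nonneg (y - a * u)]) (by linarith)

/-- The prior `π_{1:∞} = ∏ N(0, σ_i²)`. -/
def InverseProblem.prior (P : InverseProblem) : Measure (ℕ → ℝ) :=
  Measure.infinitePi fun i => gaussianReal 0 (P.priorVar i).toNNReal

/-- The posterior `μ_{1:∞} = ∏ μ_i` given the data `y`, where `μ_i` is the posterior of the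
`i`-th scalar problem given `y_i`. -/
def InverseProblem.posterior (P : InverseProblem) (y : ℕ → ℝ) : Measure (ℕ → ℝ) :=
  Measure.infinitePi fun i => scalarPosterior (P.design i) (P.noiseVar i) (P.priorVar i) (y i)

/-- The infinite-dimensional diagonal one-step filtering model
`v₁ = M v₀ + ξ`, `y = H v₁ + ζ`, `v₀ ∼ N(0, P)`, `ξ ∼ N(0, Q)`, `ζ ∼ N(0, R)`, where
`M = diag (m_i)`, `H = diag (h_i)`, `P = diag (p_i²)`, `Q = diag (q_i²)`, `R = diag (r_i²)`. -/
structure Model where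
  /-- the diagonal of `H` -/
  h : ℕ → ℝ
  /-- the diagonal of `M` -/
  m : ℕ → ℝ
  /-- the square roots of the diagonal of `P` -/
  p : ℕ → ℝ
  /-- the square roots of the diagonal of `Q` -/
  q : ℕ → ℝ
  /-- the square roots of the diagonal of `R` -/
  r : ℕ → ℝ

/-- The joint law of the triples `(v₀_i, ξ_i, ζ_i)`: all these variables are independent, with
`v₀_i ∼ N(0, p_i²)`, `ξ_i ∼ N(0, q_i²)`, `ζ_i ∼ N(0, r_i²)`. -/
def Model.noiseLaw (F : Model) : Measure (ℕ → ℝ × ℝ × ℝ) :=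
  Measure.infinitePi fun i =>
    (gaussianReal 0 (F.p i ^ 2).toNNReal).prod
      ((gaussianReal 0 (F.q i ^ 2).toNNReal).prod (gaussianReal 0 (F.r i ^ 2).toNNReal))

/-- The data `y_i = h_i v₁_i + ζ_i`, `v₁_i = m_i v₀_i + ξ_i`, as a function of the
triples `(v₀_i, ξ_i, ζ_i)`. -/
def Model.data (F : Model) (w : ℕ → ℝ × ℝ × ℝ) : ℕ → ℝ :=
  fun i => F.h i * (F.m i * (w i).1 + (w i).2.1) + (w i).2.2

/-- The law of the data `y` under the filtering model. -/
def Model.dataLaw (F : Model) : Measure (ℕ → ℝ) :=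
  F.noiseLaw.map F.data

/-- The inverse problem of the standard proposal:
`A = H`, `Γ = R`, `Σ = M P M' + Q`. -/
def Model.std (F : Model) : InverseProblem where
  design i := F.h i
  noiseVar i := F.r i ^ 2
  priorVar i := F.m i * F.p i ^ 2 * F.m i + F.q i ^ 2

/-- The inverse problem of the optimal proposal:
`A = H M`, `Γ = H Q H' + R`, `Σ = P`. -/
def Model.opt (F : Model) : InverseProblem where
  design i := F.h i * F.m i
  noiseVar i := F.h i * F.q i ^ 2 * F.h i + F.r i ^ 2
  priorVar i := F.p i ^ 2

end DiagonalFiltering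

end

/-!
Both proposals come from a diagonal inverse problem `y_i = a_i u_i + η_i` for which the filtering
data have the law prescribed by that problem: the `y_i` are independent and
`y_i ∼ N(0, a_i² σ_i² + γ_i²)` (`Model.dataLaw_opt`, `Model.dataLaw_std`). So it is enough to
prove one dichotomy, `InverseProblem.ae_absolutelyContinuous_iff`, governed by the summability of
the signal-to-noise ratios `λ_i = a_i² σ_i² / γ_i²`. For the optimal proposal these are the terms
of the series in the theorem; for the standard proposal they are the sums of the terms of its two
series, which have nonnegative terms.

For fixed data, prior and posterior are product measures, and Kakutani's argument applies.
The scalar posterior has an explicit density `g_i` with respect to the prior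
(`scalarPosterior_eq_withDensity`), and all integrals needed follow by completing the square.

* If `∑ λ_i < ∞`, then `∫ g_i² ≤ exp (λ_i + λ_i y_i² / E y_i²)`, and `∑ λ_i y_i² / E y_i²` has finite
  expectation, hence is almost surely finite. The partial products of the `g_i` are then bounded in
  `L²`; their increments being orthogonal, they converge in `L²`, and the limit is the density of
  the posterior (`exists_memLp_two_infinitePi_eq_withDensity`). This gives absolute continuity
  and `ρ < ∞` at once.
* If `∑ λ_i = ∞`, then `∫ √g_i ≤ exp (-w_i y_i²)` with `w_i = λ_i / (4 (2 + λ_i) E y_i²)`. The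
  expectation of the product of the first `n` bounds is the product of the
  `(1 + λ_i / (2 (2 + λ_i)))^(-1/2)`, which tends to `0`. So almost surely the product of the
  affinities vanishes, and by Markov's inequality the set where the partial product of the densities
  is at least `1` has prior probability tending to `0` and posterior probability tending to `1`
  (`not_infinitePi_absolutelyContinuous`).
-/

namespace DiagonalFiltering
open Filter Topology

/-! ### Product measures and product densities -/

section Product

variable {X : ℕ → Type*} [∀ i, MeasurableSpace (X i)] {π : ∀ i, Measure (X i)}
  [∀ i, IsProbabilityMeasure (π i)]

theorem lintegral_infinitePi_prod_range {f : ∀ i, X i → ℝ≥0∞} (hf : ∀ i, Measurable (f i)) (n : ℕ) :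
    ∫⁻ x, ∏ i ∈ Finset.range n, f i (x i) ∂Measure.infinitePi π
      = ∏ i ∈ Finset.range n, ∫⁻ t, f i t ∂π i := by
  have h := lintegral_prod_eq_prod_lintegral_of_indepFun (Finset.range n)
    (fun i (x : ∀ i, X i) => f i (x i)) (iIndepFun_infinitePi (P := π) hf)
    (fun i => (hf i).comp (measurable_pi_apply i))
  rw [h]
  refine Finset.prod_congr rfl fun i _ => ?_
  rw [← Measure.infinitePi_map_eval π i, lintegral_map (hf i) (measurable_pi_apply i)]

theorem integrable_infinitePi_prod_range {f : ∀ i, X i → ℝ} (hm : ∀ i, Measurable (f i))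
    (hf : ∀ i, Integrable (f i) (π i)) (n : ℕ) :
    Integrable (fun x : ∀ i, X i => ∏ i ∈ Finset.range n, f i (x i)) (Measure.infinitePi π) := by
  refine ⟨(Finset.measurable_prod _ fun i _ =>
    (hm i).comp (measurable_pi_apply i)).aestronglyMeasurable, ?_⟩
  have h : ∀ x : ∀ i, X i, ‖∏ i ∈ Finset.range n, f i (x i)‖ₑ
      = ∏ i ∈ Finset.range n, ‖f i (x i)‖ₑ := fun x => by
    simp [enorm_eq_nnnorm, nnnorm_prod]
  rw [HasFiniteIntegral]
  simp_rw [h]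
  rw [lintegral_infinitePi_prod_range (f := fun i t => ‖f i t‖ₑ) fun i => (hm i).enorm]
  exact ENNReal.prod_lt_top fun i _ => (hf i).2

theorem integral_infinitePi_prod_range {f : ∀ i, X i → ℝ} (hm : ∀ i, Measurable (f i)) (n : ℕ) :
    ∫ x, ∏ i ∈ Finset.range n, f i (x i) ∂Measure.infinitePi π
      = ∏ i ∈ Finset.range n, ∫ t, f i t ∂π i := by
  have h := (iIndepFun_infinitePi (P := π) hm).precomp
    (Subtype.val_injective (p := (· ∈ Finset.range n)))
  have h' := h.integral_fun_prod_eq_prod_integral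
    (fun i => ((hm i).comp (measurable_pi_apply (i : ℕ))).aestronglyMeasurable)
  rw [← Finset.prod_coe_sort]
  simp_rw [← Finset.prod_coe_sort (Finset.range n)]
  refine h'.trans (Finset.prod_congr rfl fun i _ => ?_)
  rw [← Measure.infinitePi_map_eval π i, integral_map (measurable_pi_apply _).aemeasurable
    (hm i).aestronglyMeasurable]

/-- Half of Kakutani's dichotomy, in its `L²` form: if the partial products of the second moments
of the densities stay bounded, the partial products of the densities form a Cauchy sequence
in `L²`, and their limit is a density of the product measure. -/
theorem exists_memLp_two_infinitePi_eq_withDensity {g : ∀ i, X i → ℝ}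
    (hm : ∀ i, Measurable (g i)) (h0 : ∀ i x, 0 ≤ g i x) (h2 : ∀ i, MemLp (g i) 2 (π i))
    (h1 : ∀ i, ∫ x, g i x ∂π i = 1) {C : ℝ}
    (hC : ∀ n, ∏ i ∈ Finset.range n, ∫ x, g i x ^ 2 ∂π i ≤ C)
    {μ : ∀ i, Measure (X i)} [∀ i, IsProbabilityMeasure (μ i)]
    (hμ : ∀ i, μ i = (π i).withDensity fun x => ENNReal.ofReal (g i x)) :
    ∃ G : (∀ i, X i) → ℝ, MemLp G 2 (Measure.infinitePi π) ∧
      Measure.infinitePi μ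
        = (Measure.infinitePi π).withDensity fun x => ENNReal.ofReal (G x) := by
  set P := Measure.infinitePi π
  have hi : ∀ i, Integrable (g i) (π i) := fun i => (h2 i).integrable (by norm_num)
  have hsq : ∀ i, Integrable (fun x => g i x ^ 2) (π i) := fun i => (h2 i).integrable_sq
  let F : ℕ → (∀ i, X i) → ℝ := fun n x => ∏ i ∈ Finset.range n, g i (x i)
  let I : ℕ → ℝ := fun n => ∏ i ∈ Finset.range n, ∫ x, g i x ^ 2 ∂π i
  have hFm : ∀ n, Measurable (F n) := fun n => Finset.measurable_prod _ fun i _ =>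
    (hm i).comp (measurable_pi_apply i)
  have hF0 : ∀ n x, 0 ≤ F n x := fun n x => Finset.prod_nonneg fun i _ => h0 i _
  have hFL : ∀ n, MemLp (F n) 2 P := fun n => by
    rw [memLp_two_iff_integrable_sq (hFm n).aestronglyMeasurable]
    simpa only [F, ← Finset.prod_pow] using
      integrable_infinitePi_prod_range (fun i => (hm i).pow_const 2) hsq n
  have hcross : ∀ m n, m ≤ n → ∫ x, F n x * F m x ∂P = I m := fun m n hmn => by
    let φ : ∀ i, X i → ℝ := fun i t => if i < m then g i t ^ 2 else g i t
    have e : ∀ x, F n x * F m x = ∏ i ∈ Finset.range n, φ i (x i) := fun x => by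
      have : F m x = ∏ i ∈ Finset.range n, if i < m then g i (x i) else 1 := by
        rw [Finset.prod_ite, Finset.prod_const_one, mul_one]
        refine Finset.prod_congr ?_ fun _ _ => rfl
        ext i
        simp only [Finset.mem_range, Finset.mem_filter]
        omega
      rw [this, ← Finset.prod_mul_distrib]
      refine Finset.prod_congr rfl fun i _ => ?_
      by_cases h : i < m <;> simp [φ, h, sq]
    rw [integral_congr_ae (ae_of_all _ e), integral_infinitePi_prod_range (f := φ)]
    · have : ∀ i, (∫ t, φ i t ∂π i)
          = if i < m then ∫ t, g i t ^ 2 ∂π i else 1 := fun i => by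
        by_cases h : i < m <;> simp [φ, h, h1]
      simp_rw [this]
      rw [Finset.prod_ite, Finset.prod_const_one, mul_one]
      refine Finset.prod_congr ?_ fun _ _ => rfl
      ext i
      simp only [Finset.mem_range, Finset.mem_filter]
      omega
    · intro i
      by_cases h : i < m
      · simpa [φ, h] using (hm i).pow_const 2
      · simpa [φ, h] using hm i
  have hρ : ∀ i, 1 ≤ ∫ x, g i x ^ 2 ∂π i := fun i => by
    have h : ∫ x, (2 * g i x - 1) ∂π i ≤ ∫ x, g i x ^ 2 ∂π i :=
      integral_mono (((hi i).const_mul 2).sub (integrable_const 1)) (hsq i)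
        fun x => by nlinarith [sq_nonneg (g i x - 1)]
    rw [integral_sub ((hi i).const_mul 2) (integrable_const 1), integral_const_mul, h1] at h
    simp at h
    linarith
  have hImono : Monotone I := monotone_nat_of_le_succ fun n => by
    simp only [I, Finset.prod_range_succ]
    exact le_mul_of_one_le_right (Finset.prod_nonneg fun i _ => zero_le_one.trans (hρ i)) (hρ n)
  have hIc : CauchySeq I :=
    (tendsto_atTop_ciSup hImono ⟨C, by rintro _ ⟨n, rfl⟩; exact hC n⟩).cauchySeq
  let L : ℕ → Lp ℝ 2 P := fun n => (hFL n).toLp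
  have hinner : ∀ m n, inner ℝ (L n) (L m) = ∫ x, F n x * F m x ∂P := fun m n => by
    rw [L2.inner_def]
    refine integral_congr_ae ?_
    filter_upwards [(hFL n).coeFn_toLp, (hFL m).coeFn_toLp] with x hx hy
    simp [L, hx, hy, mul_comm]
  have hLc : CauchySeq L := by
    rw [Metric.cauchySeq_iff'] at hIc ⊢
    intro ε hε
    obtain ⟨N, hN⟩ := hIc (ε ^ 2) (by positivity)
    refine ⟨N, fun n hn => ?_⟩
    have h := hN n hn
    rw [Real.dist_eq, abs_lt] at h
    rw [dist_eq_norm]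
    refine lt_of_pow_lt_pow_left₀ 2 hε.le ?_
    -- Orthogonality of martingale increments: `‖F n - F N‖² = I n - I N`.
    rw [norm_sub_sq_real, ← real_inner_self_eq_norm_sq, ← real_inner_self_eq_norm_sq, hinner,
      hinner, hinner, hcross N n hn, hcross n n le_rfl, hcross N N le_rfl]
    linarith [h.2]
  obtain ⟨G, hG⟩ := cauchySeq_tendsto_of_complete hLc
  -- The limit is nonnegative almost everywhere; taking `|G|` makes it so everywhere.
  refine ⟨fun x => |G x|, (Lp.memLp G).abs, ?_⟩
  have hGabs : MemLp (fun x => |G x|) 2 P := (Lp.memLp G).abs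
  have hlim : Tendsto (fun n => eLpNorm (F n - fun x => |G x|) 1 P) atTop (𝓝 0) := by
    have h := (Lp.tendsto_Lp_iff_tendsto_eLpNorm' L G).1 hG
    refine tendsto_of_tendsto_of_tendsto_of_le_of_le tendsto_const_nhds h (fun _ => zero_le)
      fun n => ?_
    refine (eLpNorm_le_eLpNorm_of_exponent_le (p := 1) (q := 2) (by norm_num)
      ((hFL n).sub hGabs).1).trans (eLpNorm_mono_ae ?_)
    filter_upwards [(hFL n).coeFn_toLp] with x hx
    simp only [Pi.sub_apply, L, hx, Real.norm_eq_abs]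
    simpa [abs_of_nonneg (hF0 n x)] using abs_abs_sub_abs_le (F n x) (G x)
  -- On a box, the integral of `F n` no longer depends on `n` once `n` exceeds the indices involved.
  refine (Measure.eq_infinitePi μ fun s t ht => ?_).symm
  have hbox : MeasurableSet (Set.pi (s : Set ℕ) t) :=
    MeasurableSet.pi s.countable_toSet fun i _ => ht i
  have hint := tendsto_setIntegral_of_L1' _ hGabs.1
    (Eventually.of_forall fun n => (hFL n).integrable (by norm_num)) hlim (Set.pi (s : Set ℕ) t)
  have hconst : ∀ᶠ n in atTop, ∫ x in Set.pi (s : Set ℕ) t, F n x ∂P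
      = ∏ i ∈ s, ∫ x in t i, g i x ∂π i := by
    filter_upwards [eventually_gt_atTop (s.sup id)] with n hn
    have hs : s ⊆ Finset.range n := fun i his =>
      Finset.mem_range.2 ((Finset.le_sup (f := id) his).trans_lt hn)
    classical
    let φ : ∀ i, X i → ℝ := fun i => if i ∈ s then (t i).indicator (g i) else g i
    have hφ : ∀ x, (Set.pi (s : Set ℕ) t).indicator (F n) x
        = ∏ i ∈ Finset.range n, φ i (x i) := fun x => by
      by_cases hx : x ∈ Set.pi (s : Set ℕ) t
      · rw [Set.indicator_of_mem hx]
        refine Finset.prod_congr rfl fun i _ => ?_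
        by_cases his : i ∈ s
        · simp [φ, his, Set.indicator_of_mem (hx i his)]
        · simp [φ, his]
      · rw [Set.indicator_of_notMem hx]
        obtain ⟨i, his, hxi⟩ : ∃ i ∈ s, x i ∉ t i := by
          simpa [Set.mem_pi] using hx
        exact (Finset.prod_eq_zero (hs his) (by simp [φ, his, hxi])).symm
    rw [← integral_indicator hbox]
    simp_rw [hφ]
    rw [integral_infinitePi_prod_range]
    · rw [← Finset.prod_subset hs]
      · refine Finset.prod_congr rfl fun i his => ?_
        simp only [φ, his, if_true]
        exact integral_indicator (ht i)
      · intro i _ his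
        simp [φ, his, h1]
    · intro i
      by_cases his : i ∈ s
      · simpa [φ, his] using (hm i).indicator (ht i)
      · simpa [φ, his] using hm i
  have heq := tendsto_nhds_unique hint (tendsto_const_nhds.congr' (hconst.mono fun n h => h.symm))
  rw [withDensity_apply _ hbox, ← ofReal_integral_eq_lintegral_ofReal
    (hGabs.integrable (by norm_num)).restrict (ae_of_all _ fun x => abs_nonneg _), heq,
    ENNReal.ofReal_prod_of_nonneg fun i _ => integral_nonneg (h0 i)]
  refine Finset.prod_congr rfl fun i _ => ?_
  rw [hμ i, withDensity_apply _ (ht i), ← ofReal_integral_eq_lintegral_ofReal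
    (hi i).restrict (ae_of_all _ (h0 i))]

/-- The other half of Kakutani's dichotomy: if the partial products of the Hellinger affinities
tend to `0`, the product measure is not absolutely continuous. -/
theorem not_infinitePi_absolutelyContinuous {g : ∀ i, X i → ℝ}
    (hm : ∀ i, Measurable (g i)) (h0 : ∀ i x, 0 < g i x)
    {μ : ∀ i, Measure (X i)} [∀ i, IsProbabilityMeasure (μ i)]
    (hμ : ∀ i, μ i = (π i).withDensity fun x => ENNReal.ofReal (g i x))
    (hH : Tendsto (fun n => ∏ i ∈ Finset.range n, ∫⁻ x, ENNReal.ofReal √(g i x) ∂π i)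
      atTop (𝓝 0)) :
    ¬ Measure.infinitePi μ ≪ Measure.infinitePi π := by
  intro hac
  set P := Measure.infinitePi π
  set Q := Measure.infinitePi μ
  let F : ℕ → (∀ i, X i) → ℝ≥0∞ := fun n x => ∏ i ∈ Finset.range n, ENNReal.ofReal √(g i (x i))
  let K : ℕ → (∀ i, X i) → ℝ≥0∞ := fun n x => ∏ i ∈ Finset.range n, ENNReal.ofReal (√(g i (x i)))⁻¹
  -- `F` is the square root of the partial density and `K` its inverse; the integral of `F` under
  -- `P` and that of `K` under `Q` are both the partial product of the affinities.
  have hFK : ∀ n x, F n x * K n x = 1 := fun n x => by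
    simp only [F, K, ← Finset.prod_mul_distrib]
    refine Finset.prod_eq_one fun i _ => ?_
    rw [← ENNReal.ofReal_mul (Real.sqrt_nonneg _),
      mul_inv_cancel₀ (Real.sqrt_pos.2 (h0 i _)).ne', ENNReal.ofReal_one]
  have hFi : ∀ n, ∫⁻ x, F n x ∂P = ∏ i ∈ Finset.range n, ∫⁻ x, ENNReal.ofReal √(g i x) ∂π i :=
    lintegral_infinitePi_prod_range (f := fun i t => ENNReal.ofReal √(g i t))
      fun i => (hm i).sqrt.ennreal_ofReal
  have hKi : ∀ n, ∫⁻ x, K n x ∂Q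
      = ∏ i ∈ Finset.range n, ∫⁻ x, ENNReal.ofReal √(g i x) ∂π i := fun n => by
    rw [show ∫⁻ x, K n x ∂Q = _ from lintegral_infinitePi_prod_range (π := μ)
      (f := fun i t => ENNReal.ofReal (√(g i t))⁻¹) (fun i => (hm i).sqrt.inv.ennreal_ofReal) n]
    refine Finset.prod_congr rfl fun i _ => ?_
    have hinv : Measurable fun x => ENNReal.ofReal (√(g i x))⁻¹ := (hm i).sqrt.inv.ennreal_ofReal
    rw [hμ i, lintegral_withDensity_eq_lintegral_mul _ (hm i).ennreal_ofReal hinv]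
    refine lintegral_congr fun x => ?_
    rw [Pi.mul_apply, ← ENNReal.ofReal_mul (h0 i x).le, ← div_eq_mul_inv, Real.div_sqrt]
  have hFm : ∀ n, Measurable (F n) := fun n => Finset.measurable_prod _ fun i _ =>
    ((hm i).comp (measurable_pi_apply i)).sqrt.ennreal_ofReal
  let A : ℕ → Set (∀ i, X i) := fun n => {x | 1 ≤ F n x}
  have hAm : ∀ n, MeasurableSet (A n) := fun n => measurableSet_le measurable_const (hFm n)
  have hPA : Tendsto (P ∘ A) atTop (𝓝 0) := by
    refine tendsto_of_tendsto_of_tendsto_of_le_of_le tendsto_const_nhds hH (fun _ => zero_le)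
      fun n => ?_
    simpa [hFi n, A] using mul_meas_ge_le_lintegral (μ := P) (hFm n) 1
  have hQA : Tendsto (fun n => Q (A n)) atTop (𝓝 0) := by
    have h := tendsto_setLIntegral_zero (μ := P) (f := Q.rnDeriv P)
      (Measure.lintegral_rnDeriv_lt_top Q P).ne hPA
    refine h.congr fun n => ?_
    rw [Measure.setLIntegral_rnDeriv hac]
  have hQAc : Tendsto (fun n => Q (A n)ᶜ) atTop (𝓝 0) := by
    refine tendsto_of_tendsto_of_tendsto_of_le_of_le tendsto_const_nhds hH (fun _ => zero_le)
      fun n => ?_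
    have hKm : Measurable (K n) := Finset.measurable_prod _ fun i _ =>
      ((hm i).comp (measurable_pi_apply i)).sqrt.inv.ennreal_ofReal
    have h : Q {x | 1 ≤ K n x}
        ≤ ∏ i ∈ Finset.range n, ∫⁻ x, ENNReal.ofReal √(g i x) ∂π i := by
      simpa [hKi n] using mul_meas_ge_le_lintegral (μ := Q) hKm 1
    refine (measure_mono fun x hx => ?_).trans h
    by_contra hk
    have hx' : F n x < 1 := by simpa [A] using hx
    have hk' : K n x < 1 := by simpa using hk
    have := ENNReal.mul_lt_mul hx' hk'
    rw [hFK, one_mul] at this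
    exact this.false
  have hsum := hQA.add hQAc
  simp_rw [measure_add_measure_compl (hAm _), measure_univ, add_zero] at hsum
  exact one_ne_zero (tendsto_nhds_unique tendsto_const_nhds hsum)

end Product

/-! ### Gaussian integrals and the scalar posterior -/

/-- Completing the square: up to a constant, a quadratic exponential times the density of
`N(0, v)` is the density of `N(b v / (1 + c v), v / (1 + c v))`. -/
theorem lintegral_gaussianReal_exp_quadratic {v : ℝ} (hv : 0 < v) {c : ℝ} (hc : 0 < 1 + c * v)
    (b d : ℝ) :
    ∫⁻ x, ENNReal.ofReal (Real.exp (-(c * x ^ 2 / 2) + b * x + d)) ∂gaussianReal 0 v.toNNReal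
      = ENNReal.ofReal ((√(1 + c * v))⁻¹ * Real.exp (b ^ 2 * v / (2 * (1 + c * v)) + d)) := by
  have hv' : v.toNNReal ≠ 0 := by simpa using hv
  have hw : 0 < v / (1 + c * v) := div_pos hv hc
  have hw' : (v / (1 + c * v)).toNNReal ≠ 0 := by simpa using hw
  rw [gaussianReal_of_var_ne_zero _ hv', lintegral_withDensity_eq_lintegral_mul _
    (measurable_gaussianPDF _ _) (by fun_prop)]
  have key : ∀ x, (gaussianPDF 0 v.toNNReal
        * fun x => ENNReal.ofReal (Real.exp (-(c * x ^ 2 / 2) + b * x + d))) x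
      = ENNReal.ofReal ((√(1 + c * v))⁻¹ * Real.exp (b ^ 2 * v / (2 * (1 + c * v)) + d))
        * gaussianPDF (b * v / (1 + c * v)) (v / (1 + c * v)).toNNReal x := fun x => by
    rw [Pi.mul_apply, gaussianPDF, gaussianPDF, ← ENNReal.ofReal_mul (gaussianPDFReal_nonneg _ _ _),
      ← ENNReal.ofReal_mul (by positivity)]
    congr 1
    rw [gaussianPDFReal, gaussianPDFReal, Real.coe_toNNReal _ hv.le, Real.coe_toNNReal _ hw.le]
    have h1 : (√(1 + c * v))⁻¹ * (√(2 * Real.pi * (v / (1 + c * v))))⁻¹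
        = (√(2 * Real.pi * v))⁻¹ := by
      rw [← mul_inv, ← Real.sqrt_mul hc.le]
      congr 2
      field_simp
    have h2 : b ^ 2 * v / (2 * (1 + c * v)) + d
          + -(x - b * v / (1 + c * v)) ^ 2 / (2 * (v / (1 + c * v)))
        = -(x - 0) ^ 2 / (2 * v) + (-(c * x ^ 2 / 2) + b * x + d) := by
      have h3 : ∀ w : ℝ, w ≠ 0 → b ^ 2 * v / (2 * w) + d + -(x - b * v / w) ^ 2 / (2 * (v / w))
          = -(w * x ^ 2) / (2 * v) + b * x + d := fun w hw => by
        field_simp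
        ring
      rw [h3 _ hc.ne']
      field_simp
      ring
    rw [← h1, mul_assoc, ← Real.exp_add, ← h2, Real.exp_add (b ^ 2 * v / (2 * (1 + c * v)) + d)]
    ring
  simp_rw [key]
  rw [lintegral_const_mul _ (measurable_gaussianPDF _ _), lintegral_gaussianPDF_eq_one _ hw',
    mul_one]

/-- The density of the posterior of the scalar problem with respect to the prior `N(0, v)`, in
the form `√(1 + c v) exp (-c u² / 2 + b u - b² v / (2 (1 + c v)))`, where `c = a² / γ²` and
`b = a y / γ²`. -/
noncomputable def posteriorDensity (a γsq v y u : ℝ) : ℝ :=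
  √(1 + a ^ 2 / γsq * v) * Real.exp (-(a ^ 2 / γsq * u ^ 2 / 2) + a * y / γsq * u
    + -((a * y / γsq) ^ 2 * v / (2 * (1 + a ^ 2 / γsq * v))))

section

variable {a γsq v y : ℝ}

theorem measurable_posteriorDensity : Measurable (posteriorDensity a γsq v y) := by
  unfold posteriorDensity
  fun_prop

theorem posteriorDensity_pos (hγ : 0 < γsq) (hv : 0 < v) (u : ℝ) :
    0 < posteriorDensity a γsq v y u := by
  unfold posteriorDensity
  positivity

theorem scalarPosterior_eq_withDensity (hγ : 0 < γsq) (hv : 0 < v) :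
    scalarPosterior a γsq v y = (gaussianReal 0 v.toNNReal).withDensity
      fun u => ENNReal.ofReal (posteriorDensity a γsq v y u) := by
  have hc : 0 < 1 + a ^ 2 / γsq * v := by positivity
  have hexp : ∀ u, -(y - a * u) ^ 2 / (2 * γsq)
      = -(a ^ 2 / γsq * u ^ 2 / 2) + a * y / γsq * u + -(y ^ 2 / (2 * γsq)) := fun u => by
    field_simp
    ring
  have hZ : ∫ u, Real.exp (-(y - a * u) ^ 2 / (2 * γsq)) ∂gaussianReal 0 v.toNNReal
      = (√(1 + a ^ 2 / γsq * v))⁻¹ * Real.exp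
        ((a * y / γsq) ^ 2 * v / (2 * (1 + a ^ 2 / γsq * v)) + -(y ^ 2 / (2 * γsq))) := by
    rw [integral_eq_lintegral_of_nonneg_ae (ae_of_all _ fun _ => (Real.exp_pos _).le)
      (by fun_prop)]
    simp_rw [hexp]
    rw [lintegral_gaussianReal_exp_quadratic hv hc, ENNReal.toReal_ofReal (by positivity)]
  rw [scalarPosterior, Measure.tilted]
  congr 1
  ext u
  rw [hZ, hexp, posteriorDensity, div_eq_mul_inv, mul_inv, inv_inv, ← Real.exp_neg]
  congr 1
  rw [mul_left_comm, ← Real.exp_add]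
  congr 2
  ring

/-- A bound on the second moment of the posterior density. With `λ = a² v / γ²`, the exact value is
`(1 + λ) / √(1 + 2 λ) exp (λ y² / ((1 + 2 λ) (a² v + γ²)))`. -/
theorem lintegral_posteriorDensity_sq_le (hγ : 0 < γsq) (hv : 0 < v) :
    ∫⁻ u, ENNReal.ofReal (posteriorDensity a γsq v y u ^ 2) ∂gaussianReal 0 v.toNNReal
      ≤ ENNReal.ofReal (Real.exp
        (a ^ 2 * v / γsq + a ^ 2 * v / γsq * (y ^ 2 / (a ^ 2 * v + γsq)))) := by
  have hc : 0 < 1 + a ^ 2 / γsq * v := by positivity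
  have hc2 : 0 < 1 + 2 * (a ^ 2 / γsq) * v := by positivity
  have e : ∀ u, ENNReal.ofReal (posteriorDensity a γsq v y u ^ 2)
      = ENNReal.ofReal (1 + a ^ 2 / γsq * v) * ENNReal.ofReal (Real.exp
        (-(2 * (a ^ 2 / γsq) * u ^ 2 / 2) + 2 * (a * y / γsq) * u
          + -((a * y / γsq) ^ 2 * v / (1 + a ^ 2 / γsq * v)))) := fun u => by
    rw [← ENNReal.ofReal_mul hc.le, posteriorDensity, mul_pow, Real.sq_sqrt hc.le,
      ← Real.exp_nat_mul]
    congr 3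
    field_simp
    push_cast
    ring
  simp_rw [e]
  rw [lintegral_const_mul _ (by fun_prop), lintegral_gaussianReal_exp_quadratic hv hc2,
    ← ENNReal.ofReal_mul hc.le]
  refine ENNReal.ofReal_le_ofReal ?_
  have h1 : (√(1 + 2 * (a ^ 2 / γsq) * v))⁻¹ ≤ 1 :=
    inv_le_one_of_one_le₀ (Real.one_le_sqrt.2 (by
      have : 0 ≤ 2 * (a ^ 2 / γsq) * v := by positivity
      linarith))
  have h2 : 1 + a ^ 2 / γsq * v ≤ Real.exp (a ^ 2 * v / γsq) := by
    have := Real.add_one_le_exp (a ^ 2 * v / γsq)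
    rw [div_mul_eq_mul_div]
    linarith
  have h3 : (2 * (a * y / γsq)) ^ 2 * v / (2 * (1 + 2 * (a ^ 2 / γsq) * v))
      + -((a * y / γsq) ^ 2 * v / (1 + a ^ 2 / γsq * v))
      ≤ a ^ 2 * v / γsq * (y ^ 2 / (a ^ 2 * v + γsq)) := by
    have h4 : a ^ 2 * v / γsq * (y ^ 2 / (a ^ 2 * v + γsq))
        - ((2 * (a * y / γsq)) ^ 2 * v / (2 * (1 + 2 * (a ^ 2 / γsq) * v))
          + -((a * y / γsq) ^ 2 * v / (1 + a ^ 2 / γsq * v)))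
        = 2 * (a ^ 2 * v) ^ 2 * y ^ 2
          / (γsq * (a ^ 2 * v + γsq) * (γsq + 2 * a ^ 2 * v)) := by
      field_simp
      ring
    have h5 : 0 ≤ 2 * (a ^ 2 * v) ^ 2 * y ^ 2
          / (γsq * (a ^ 2 * v + γsq) * (γsq + 2 * a ^ 2 * v)) := by positivity
    linarith
  calc _ ≤ Real.exp (a ^ 2 * v / γsq) * (1 * Real.exp
        (a ^ 2 * v / γsq * (y ^ 2 / (a ^ 2 * v + γsq)))) := by gcongr
    _ = _ := by rw [one_mul, Real.exp_add]

/-- A bound on the Hellinger affinity of the scalar posterior and prior. The factor dropped from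
the exact value, `(1 + λ)^(1/4) / (1 + λ / 2)^(1/2)` with `λ = a² v / γ²`, is at most `1`. -/
theorem lintegral_sqrt_posteriorDensity_le (hγ : 0 < γsq) (hv : 0 < v) :
    ∫⁻ u, ENNReal.ofReal √(posteriorDensity a γsq v y u) ∂gaussianReal 0 v.toNNReal
      ≤ ENNReal.ofReal (Real.exp
        (-(a ^ 2 * v / (4 * (a ^ 2 * v + 2 * γsq) * (a ^ 2 * v + γsq)) * y ^ 2))) := by
  have hc : 0 < 1 + a ^ 2 / γsq * v := by positivity
  have hc2 : 0 < 1 + a ^ 2 / γsq / 2 * v := by positivity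
  have e : ∀ u, ENNReal.ofReal √(posteriorDensity a γsq v y u)
      = ENNReal.ofReal √√(1 + a ^ 2 / γsq * v) * ENNReal.ofReal (Real.exp
        (-(a ^ 2 / γsq / 2 * u ^ 2 / 2) + a * y / γsq / 2 * u
          + -((a * y / γsq) ^ 2 * v / (4 * (1 + a ^ 2 / γsq * v))))) := fun u => by
    rw [← ENNReal.ofReal_mul (by positivity), posteriorDensity, Real.sqrt_mul (by positivity),
      ← Real.exp_half]
    congr 3
    field_simp
    ring
  simp_rw [e]
  rw [lintegral_const_mul _ (by fun_prop), lintegral_gaussianReal_exp_quadratic hv hc2,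
    ← ENNReal.ofReal_mul (by positivity)]
  refine ENNReal.ofReal_le_ofReal ?_
  rw [← mul_assoc]
  have h1 : √√(1 + a ^ 2 / γsq * v) * (√(1 + a ^ 2 / γsq / 2 * v))⁻¹ ≤ 1 := by
    rw [← div_eq_mul_inv, div_le_one (by positivity)]
    refine Real.sqrt_le_sqrt (Real.sqrt_le_iff.2 ⟨by positivity, ?_⟩)
    nlinarith [sq_nonneg (a ^ 2 / γsq * v)]
  have h2 : (a * y / γsq / 2) ^ 2 * v / (2 * (1 + a ^ 2 / γsq / 2 * v))
        + -((a * y / γsq) ^ 2 * v / (4 * (1 + a ^ 2 / γsq * v)))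
      = -(a ^ 2 * v / (4 * (a ^ 2 * v + 2 * γsq) * (a ^ 2 * v + γsq)) * y ^ 2) := by
    field_simp
    ring
  rw [h2]
  exact mul_le_of_le_one_left (Real.exp_pos _).le h1

end

/-! ### The dichotomy for a diagonal inverse problem -/

/-- The signal-to-noise ratio `a_i² σ_i² / γ_i²` of the `i`-th scalar problem. -/
noncomputable def InverseProblem.snr (P : InverseProblem) (i : ℕ) : ℝ :=
  P.design i ^ 2 * P.priorVar i / P.noiseVar i

/-- The variance `a_i² σ_i² + γ_i²` of the `i`-th observation. -/
def InverseProblem.dataVar (P : InverseProblem) (i : ℕ) : ℝ :=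
  P.design i ^ 2 * P.priorVar i + P.noiseVar i

/-- The law of the data `y_i = a_i u_i + η_i` of an inverse problem: the coordinates are
independent, with `y_i ∼ N(0, a_i² σ_i² + γ_i²)`. -/
noncomputable def InverseProblem.dataLaw (P : InverseProblem) : Measure (ℕ → ℝ) :=
  Measure.infinitePi fun i => gaussianReal 0 (P.dataVar i).toNNReal

/-- The coefficient of `y_i²` in the exponential bound on the `i`-th Hellinger affinity. -/
noncomputable def InverseProblem.hellingerWeight (P : InverseProblem) (i : ℕ) : ℝ :=
  P.design i ^ 2 * P.priorVar i
    / (4 * (P.design i ^ 2 * P.priorVar i + 2 * P.noiseVar i) * P.dataVar i)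

theorem lintegral_gaussianReal_sq {s : ℝ} (hs : 0 < s) :
    ∫⁻ y, ENNReal.ofReal (y ^ 2) ∂gaussianReal 0 s.toNNReal = ENNReal.ofReal s := by
  have hi : Integrable (fun y : ℝ => y ^ 2) (gaussianReal 0 s.toNNReal) :=
    (memLp_id_gaussianReal 2).integrable_sq
  rw [← ofReal_integral_eq_lintegral_ofReal hi (ae_of_all _ fun _ => sq_nonneg _)]
  have h := variance_of_integral_eq_zero (X := id) (μ := gaussianReal 0 s.toNNReal)
    aemeasurable_id (by simp)
  rw [variance_id_gaussianReal, Real.coe_toNNReal _ hs.le] at h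
  exact congrArg ENNReal.ofReal h.symm

theorem tendsto_prod_zero_of_not_summable {x : ℕ → ℝ} (h0 : ∀ i, 0 ≤ x i) (hx : ¬ Summable x) :
    Tendsto (fun n => ∏ i ∈ Finset.range n, (√(1 + x i))⁻¹) atTop (𝓝 0) := by
  have h1 : Tendsto (fun n => (√(1 + ∑ i ∈ Finset.range n, x i))⁻¹) atTop (𝓝 0) :=
    tendsto_inv_atTop_zero.comp (Real.tendsto_sqrt_atTop.comp
      (tendsto_atTop_add_const_left _ 1
        ((not_summable_iff_tendsto_nat_atTop_of_nonneg h0).1 hx)))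
  refine squeeze_zero (fun n => by positivity) (fun n => ?_) h1
  have hsum : 0 ≤ ∑ i ∈ Finset.range n, x i := Finset.sum_nonneg fun i _ => h0 i
  rw [Finset.prod_inv_distrib, ← Real.sqrt_prod _ fun i _ => by have := h0 i; linarith]
  refine inv_anti₀ (Real.sqrt_pos.2 (by linarith)) (Real.sqrt_le_sqrt ?_)
  induction n with
  | zero => simp
  | succ n ih =>
    have hn : 0 ≤ ∑ i ∈ Finset.range n, x i := Finset.sum_nonneg fun i _ => h0 i
    rw [Finset.sum_range_succ, Finset.prod_range_succ]
    nlinarith [ih hn, h0 n, mul_le_mul_of_nonneg_right (ih hn) (h0 n), mul_nonneg hn (h0 n)]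

/-- `λ / (2 (2 + λ))` with `λ = t / γ` is summable only if `λ` is. -/
theorem summable_div_of_summable_div_add {t γ : ℕ → ℝ} (ht : ∀ i, 0 ≤ t i) (hγ : ∀ i, 0 < γ i)
    (h : Summable fun i => t i / (2 * (t i + 2 * γ i))) : Summable fun i => t i / γ i := by
  -- As soon as `λ / (2 (2 + λ)) < 1 / 4`, one has `λ < 2`, so `λ` is at most `8` times that term.
  refine Summable.of_norm_bounded_eventually_nat (h.mul_left 8) ?_
  filter_upwards [h.tendsto_atTop_zero.eventually (gt_mem_nhds (show (0 : ℝ) < 1 / 4 by norm_num))]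
    with i hi
  have h1 := ht i
  have h2 := hγ i
  rw [div_lt_iff₀ (by positivity)] at hi
  rw [Real.norm_of_nonneg (by positivity), ← mul_div_assoc, div_le_div_iff₀ h2 (by positivity)]
  nlinarith

/-- A decreasing sequence of functions whose integrals tend to `0` tends to `0` almost
everywhere. -/
theorem ae_tendsto_zero_of_antitone {α : Type*} [MeasurableSpace α] {ν : Measure α}
    {D : ℕ → α → ℝ≥0∞} (hm : ∀ n, Measurable (D n)) (ha : ∀ x, Antitone fun n => D n x)
    (h : Tendsto (fun n => ∫⁻ x, D n x ∂ν) atTop (𝓝 0)) :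
    ∀ᵐ x ∂ν, Tendsto (fun n => D n x) atTop (𝓝 0) := by
  have h0 : ∫⁻ x, ⨅ n, D n x ∂ν = 0 :=
    le_antisymm (ge_of_tendsto' h fun n => lintegral_mono fun x => iInf_le _ n) zero_le
  rw [lintegral_eq_zero_iff (.iInf hm)] at h0
  filter_upwards [h0] with x hx
  have := tendsto_atTop_iInf (ha x)
  rwa [show ⨅ n, D n x = 0 from hx] at this

namespace InverseProblem

variable {P : InverseProblem}

theorem snr_nonneg (hγ : ∀ i, 0 < P.noiseVar i) (hv : ∀ i, 0 < P.priorVar i) (i : ℕ) :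
    0 ≤ P.snr i :=
  div_nonneg (mul_nonneg (sq_nonneg _) (hv i).le) (hγ i).le

theorem dataVar_pos (hγ : ∀ i, 0 < P.noiseVar i) (hv : ∀ i, 0 < P.priorVar i) (i : ℕ) :
    0 < P.dataVar i :=
  add_pos_of_nonneg_of_pos (mul_nonneg (sq_nonneg _) (hv i).le) (hγ i)

/-- If the signal-to-noise ratios are summable, then so are, almost surely, their multiples by
`y_i² / E y_i²`, which have the same expectations. -/
theorem ae_summable_mul_sq (hγ : ∀ i, 0 < P.noiseVar i) (hv : ∀ i, 0 < P.priorVar i)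
    (hS : Summable P.snr) :
    ∀ᵐ y ∂P.dataLaw, Summable fun i => P.snr i * (y i ^ 2 / P.dataVar i) := by
  have hl := snr_nonneg hγ hv
  have hs := dataVar_pos hγ hv
  have h1 : ∀ i, ∫⁻ y, ENNReal.ofReal (P.snr i * (y i ^ 2 / P.dataVar i)) ∂P.dataLaw = ENNReal.ofReal (P.snr i) := fun i => by
    have hmap := Measure.infinitePi_map_eval (fun i => gaussianReal 0 (P.dataVar i).toNNReal) i
    rw [← InverseProblem.dataLaw] at hmap
    have h := lintegral_map (μ := P.dataLaw) (f := fun t : ℝ => ENNReal.ofReal (t ^ 2))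
      (by fun_prop) (measurable_pi_apply i)
    rw [hmap, lintegral_gaussianReal_sq (hs i)] at h
    have e : ∀ t : ℝ, ENNReal.ofReal (P.snr i * (t ^ 2 / P.dataVar i))
        = ENNReal.ofReal (P.snr i / P.dataVar i) * ENNReal.ofReal (t ^ 2) := fun t => by
      rw [← ENNReal.ofReal_mul (div_nonneg (hl i) (hs i).le)]
      congr 1
      ring
    simp_rw [e]
    rw [lintegral_const_mul _ (by fun_prop), ← h,
      ← ENNReal.ofReal_mul (div_nonneg (hl i) (hs i).le), div_mul_cancel₀ _ (hs i).ne']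
  have hmeas : ∀ i, Measurable fun y : ℕ → ℝ => ENNReal.ofReal (P.snr i
      * (y i ^ 2 / P.dataVar i)) := fun i =>
    ((((measurable_pi_apply i).pow_const 2).div_const _).const_mul _).ennreal_ofReal
  have h2 : ∫⁻ y, ∑' i, ENNReal.ofReal (P.snr i * (y i ^ 2 / P.dataVar i)) ∂P.dataLaw ≠ ∞ := by
    rw [lintegral_tsum fun i => (hmeas i).aemeasurable]
    simp_rw [h1]
    exact hS.tsum_ofReal_ne_top
  filter_upwards [ae_lt_top (Measurable.tsum hmeas) h2] with y hy
  have h := ENNReal.summable_toReal hy.ne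
  refine h.congr fun i => ENNReal.toReal_ofReal (mul_nonneg (hl i) (div_nonneg (sq_nonneg _)
    (hs i).le))

/-- If the signal-to-noise ratios are not summable, the bounds on the Hellinger affinities of the
posterior and the prior almost surely have product `0`: the expectations of the decreasing partial
products tend to `0`. -/
theorem ae_tendsto_prod_exp (hγ : ∀ i, 0 < P.noiseVar i) (hv : ∀ i, 0 < P.priorVar i)
    (hS : ¬ Summable P.snr) :
    ∀ᵐ y ∂P.dataLaw, Tendsto (fun n => ∏ i ∈ Finset.range n,
      ENNReal.ofReal (Real.exp (-(P.hellingerWeight i * y i ^ 2)))) atTop (𝓝 0) := by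
  have ht : ∀ i, 0 ≤ P.design i ^ 2 * P.priorVar i := fun i => by
    have := hv i; positivity
  have hs := dataVar_pos hγ hv
  have hw : ∀ i, 0 ≤ P.hellingerWeight i := fun i => by
    have := hγ i; have := ht i; have := hs i; unfold hellingerWeight; positivity
  have hws : ∀ i, 2 * P.hellingerWeight i * P.dataVar i
      = P.design i ^ 2 * P.priorVar i
        / (2 * (P.design i ^ 2 * P.priorVar i + 2 * P.noiseVar i)) := fun i => by
    have h1 := (hs i).ne'
    have h2 : P.design i ^ 2 * P.priorVar i + 2 * P.noiseVar i ≠ 0 := by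
      have := ht i; have := hγ i; linarith
    unfold hellingerWeight
    field_simp
    ring
  refine ae_tendsto_zero_of_antitone (fun n => by fun_prop) (fun y => ?_) ?_
  · refine antitone_nat_of_succ_le fun n => ?_
    rw [Finset.prod_range_succ]
    refine mul_le_of_le_one_right' (ENNReal.ofReal_le_one.2 (Real.exp_le_one_iff.2 ?_))
    have := mul_nonneg (hw n) (sq_nonneg (y n))
    linarith
  · have hi : ∀ n, ∫⁻ y, ∏ i ∈ Finset.range n,
        ENNReal.ofReal (Real.exp (-(P.hellingerWeight i * y i ^ 2))) ∂P.dataLaw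
        = ENNReal.ofReal (∏ i ∈ Finset.range n, (√(1 + P.design i ^ 2 * P.priorVar i
        / (2 * (P.design i ^ 2 * P.priorVar i + 2 * P.noiseVar i))))⁻¹) := fun n => by
      rw [ENNReal.ofReal_prod_of_nonneg fun i _ => by positivity]
      refine (lintegral_infinitePi_prod_range
        (f := fun i t => ENNReal.ofReal (Real.exp (-(P.hellingerWeight i * t ^ 2))))
        (fun i => by fun_prop) n).trans (Finset.prod_congr rfl fun i _ => ?_)
      have h := lintegral_gaussianReal_exp_quadratic (hs i) (c := 2 * P.hellingerWeight i)
        (by have := mul_nonneg (hw i) (hs i).le; linarith) 0 0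
      rw [hws] at h
      simp only [zero_mul, add_zero, ne_eq, OfNat.ofNat_ne_zero, not_false_eq_true, zero_pow,
        zero_div, Real.exp_zero, mul_one] at h
      rw [← h]
      refine lintegral_congr fun x => ?_
      congr 3
      ring
    simp_rw [hi]
    rw [← ENNReal.ofReal_zero]
    refine ENNReal.tendsto_ofReal (tendsto_prod_zero_of_not_summable (fun i => ?_)
      fun h => hS (summable_div_of_summable_div_add ht hγ h))
    have := hγ i; have := ht i; positivity

/-- If the signal-to-noise ratios and the exponents bounding the second moments of the posterior
densities are summable, the posterior has a square-integrable density. -/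
theorem posterior_absolutelyContinuous_and_rho_lt_top (hγ : ∀ i, 0 < P.noiseVar i)
    (hv : ∀ i, 0 < P.priorVar i) (hS : Summable P.snr) {y : ℕ → ℝ}
    (hy : Summable fun i => P.snr i * (y i ^ 2 / P.dataVar i)) :
    P.posterior y ≪ P.prior ∧ rho (P.posterior y) P.prior < ∞ := by
  have : ∀ i, IsProbabilityMeasure
      (scalarPosterior (P.design i) (P.noiseVar i) (P.priorVar i) (y i)) :=
    fun i => isProbabilityMeasure_scalarPosterior _ _ _ (hγ i).le
  let π : ℕ → Measure ℝ := fun i => gaussianReal 0 (P.priorVar i).toNNReal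
  let g : ℕ → ℝ → ℝ := fun i =>
    posteriorDensity (P.design i) (P.noiseVar i) (P.priorVar i) (y i)
  have hm : ∀ i, Measurable (g i) := fun i => measurable_posteriorDensity
  have h0 : ∀ i u, 0 ≤ g i u := fun i u => (posteriorDensity_pos (hγ i) (hv i) u).le
  have hμ := fun i => scalarPosterior_eq_withDensity (a := P.design i) (y := y i) (hγ i) (hv i)
  have hsq : ∀ i, ∫⁻ u, ENNReal.ofReal (g i u ^ 2) ∂π i
      ≤ ENNReal.ofReal (Real.exp (P.snr i + P.snr i * (y i ^ 2 / P.dataVar i))) := fun i =>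
    lintegral_posteriorDensity_sq_le (hγ i) (hv i)
  have h2 : ∀ i, MemLp (g i) 2 (π i) := fun i => by
    rw [memLp_two_iff_integrable_sq (hm i).aestronglyMeasurable]
    refine (lintegral_ofReal_ne_top_iff_integrable ((hm i).pow_const 2).aestronglyMeasurable
      (ae_of_all _ fun _ => sq_nonneg _)).1 ?_
    exact ((hsq i).trans_lt ENNReal.ofReal_lt_top).ne
  have h1 : ∀ i, ∫ u, g i u ∂π i = 1 := fun i => by
    rw [integral_eq_lintegral_of_nonneg_ae (ae_of_all _ (h0 i)) (hm i).aestronglyMeasurable]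
    have h := measure_univ (μ := scalarPosterior (P.design i) (P.noiseVar i) (P.priorVar i) (y i))
    rw [hμ i, withDensity_apply _ MeasurableSet.univ, setLIntegral_univ] at h
    exact (congrArg ENNReal.toReal h).trans ENNReal.toReal_one
  have hC : ∀ n, ∏ i ∈ Finset.range n, ∫ u, g i u ^ 2 ∂π i
      ≤ Real.exp (∑' i, (P.snr i + P.snr i * (y i ^ 2 / P.dataVar i))) := fun n => by
    refine (Finset.prod_le_prod (g := fun i => Real.exp (P.snr i + P.snr i * (y i ^ 2 / P.dataVar i)))
      (fun i _ => integral_nonneg fun u => sq_nonneg _) fun i _ => ?_).trans ?_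
    · rw [integral_eq_lintegral_of_nonneg_ae (ae_of_all _ fun _ => sq_nonneg _)
        ((hm i).pow_const 2).aestronglyMeasurable]
      exact ENNReal.toReal_le_of_le_ofReal (Real.exp_pos _).le (hsq i)
    · rw [← Real.exp_sum]
      refine Real.exp_le_exp.2 ((hS.add hy).sum_le_tsum _ fun i _ => ?_)
      exact add_nonneg (snr_nonneg hγ hv i) (mul_nonneg (snr_nonneg hγ hv i)
        (div_nonneg (sq_nonneg _) (dataVar_pos hγ hv i).le))
  obtain ⟨G, hG, hPG⟩ := exists_memLp_two_infinitePi_eq_withDensity hm h0 h2 h1 hC hμ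
  have hPG' : P.posterior y = P.prior.withDensity fun x => ENNReal.ofReal (G x) := hPG
  have hGm : AEMeasurable (fun x => ENNReal.ofReal (G x)) P.prior :=
    hG.1.aemeasurable.ennreal_ofReal
  have hac : P.posterior y ≪ P.prior := by
    rw [hPG']
    exact withDensity_absolutelyContinuous _ _
  refine ⟨hac, ?_⟩
  have : IsProbabilityMeasure P.prior := by unfold prior; infer_instance
  have hrn : ∫⁻ x, (P.posterior y).rnDeriv P.prior x ^ 2 ∂P.prior < ∞ := by
    have hle : ∫⁻ x, (P.posterior y).rnDeriv P.prior x ^ 2 ∂P.prior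
        ≤ ∫⁻ x, ‖G x ^ 2‖ₑ ∂P.prior := by
      refine lintegral_mono_ae ?_
      have h := Measure.rnDeriv_withDensity₀ P.prior hGm
      rw [← hPG'] at h
      filter_upwards [h] with x hx
      rw [hx, enorm_pow]
      gcongr
      rw [Real.enorm_eq_ofReal_abs]
      exact ENNReal.ofReal_le_ofReal (le_abs_self _)
    exact hle.trans_lt hG.integrable_sq.2
  rw [rho, chiSqDiv, if_pos hac]
  exact ENNReal.add_lt_top.2 ⟨tsub_le_self.trans_lt hrn, ENNReal.one_lt_top⟩

/-- If the bounds on the Hellinger affinities have product `0`, the posterior is not absolutely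
continuous. -/
theorem not_posterior_absolutelyContinuous (hγ : ∀ i, 0 < P.noiseVar i)
    (hv : ∀ i, 0 < P.priorVar i) {y : ℕ → ℝ}
    (hy : Tendsto (fun n => ∏ i ∈ Finset.range n,
      ENNReal.ofReal (Real.exp (-(P.hellingerWeight i * y i ^ 2)))) atTop (𝓝 0)) :
    ¬ P.posterior y ≪ P.prior := by
  have : ∀ i, IsProbabilityMeasure
      (scalarPosterior (P.design i) (P.noiseVar i) (P.priorVar i) (y i)) :=
    fun i => isProbabilityMeasure_scalarPosterior _ _ _ (hγ i).le
  refine not_infinitePi_absolutelyContinuous (fun i => measurable_posteriorDensity)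
    (fun i u => posteriorDensity_pos (hγ i) (hv i) u)
    (fun i => scalarPosterior_eq_withDensity (hγ i) (hv i)) ?_
  refine tendsto_of_tendsto_of_tendsto_of_le_of_le tendsto_const_nhds hy (fun _ => zero_le)
    fun n => Finset.prod_le_prod' fun i _ => ?_
  exact lintegral_sqrt_posteriorDensity_le (hγ i) (hv i)

/-- The dichotomy for a diagonal inverse problem: the posterior is absolutely continuous with
finite `χ²`-divergence or not absolutely continuous at all, according to whether the
signal-to-noise ratios are summable. -/
theorem ae_absolutelyContinuous_iff (hγ : ∀ i, 0 < P.noiseVar i) (hv : ∀ i, 0 < P.priorVar i) :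
    ∀ᵐ y ∂P.dataLaw,
      ((P.posterior y ≪ P.prior ∧ rho (P.posterior y) P.prior < ∞) ↔
        Summable P.snr) ∧
      (P.posterior y ≪ P.prior ↔
        Summable P.snr) := by
  by_cases hS : Summable P.snr
  · filter_upwards [ae_summable_mul_sq hγ hv hS] with y hy
    have h := posterior_absolutelyContinuous_and_rho_lt_top hγ hv hS hy
    exact ⟨iff_of_true h hS, iff_of_true h.1 hS⟩
  · filter_upwards [ae_tendsto_prod_exp hγ hv hS] with y hy
    have h := not_posterior_absolutelyContinuous hγ hv hy
    exact ⟨iff_of_false (fun h' => h h'.1) hS, iff_of_false h hS⟩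

end InverseProblem

/-! ### The filtering model -/

/-- A linear combination of three independent centred Gaussian variables is Gaussian. -/
theorem map_gaussianReal_prod (h m : ℝ) (v₁ v₂ v₃ : ℝ≥0) :
    ((gaussianReal 0 v₁).prod ((gaussianReal 0 v₂).prod (gaussianReal 0 v₃))).map
        (fun w : ℝ × ℝ × ℝ => h * (m * w.1 + w.2.1) + w.2.2)
      = gaussianReal 0 (h ^ 2 * (m ^ 2 * v₁ + v₂) + v₃).toNNReal := by
  have h23 : ((gaussianReal 0 v₂).prod (gaussianReal 0 v₃)).map
      (fun w : ℝ × ℝ => h * w.1 + w.2) = gaussianReal 0 (h ^ 2 * v₂ + v₃ : ℝ).toNNReal := by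
    have e : (fun w : ℝ × ℝ => h * w.1 + w.2)
        = (fun w : ℝ × ℝ => w.1 + w.2) ∘ Prod.map (fun t => h * t) id := rfl
    rw [e, ← Measure.map_map (by fun_prop) (by fun_prop),
      ← Measure.map_prod_map _ _ (by fun_prop) (by fun_prop), gaussianReal_map_const_mul,
      Measure.map_id, ← Measure.conv, gaussianReal_conv_gaussianReal]
    congr 1
    · simp
    · ext
      rw [Real.coe_toNNReal _ (by positivity)]
      rfl
  have e : (fun w : ℝ × ℝ × ℝ => h * (m * w.1 + w.2.1) + w.2.2)
      = (fun w : ℝ × ℝ => w.1 + w.2)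
        ∘ Prod.map (fun t => h * m * t) (fun w : ℝ × ℝ => h * w.1 + w.2) := by
    ext w
    simp only [Function.comp_apply, Prod.map_fst, Prod.map_snd]
    ring
  rw [e, ← Measure.map_map (by fun_prop) (by fun_prop),
    ← Measure.map_prod_map _ _ (by fun_prop) (by fun_prop), h23, gaussianReal_map_const_mul,
    ← Measure.conv, gaussianReal_conv_gaussianReal]
  congr 1
  · simp
  · ext
    rw [NNReal.coe_add, NNReal.coe_mul, Real.coe_toNNReal _ (by positivity),
      Real.coe_toNNReal _ (by positivity), NNReal.coe_mk]
    ring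

theorem Model.dataLaw_eq (F : Model) :
    F.dataLaw = Measure.infinitePi fun i => gaussianReal 0
      (F.h i ^ 2 * (F.m i ^ 2 * F.p i ^ 2 + F.q i ^ 2) + F.r i ^ 2).toNNReal := by
  have h := Measure.infinitePi_map_pi (μ := fun i =>
    (gaussianReal 0 (F.p i ^ 2).toNNReal).prod
      ((gaussianReal 0 (F.q i ^ 2).toNNReal).prod (gaussianReal 0 (F.r i ^ 2).toNNReal)))
    (f := fun i (w : ℝ × ℝ × ℝ) => F.h i * (F.m i * w.1 + w.2.1) + w.2.2) (fun i => by fun_prop)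
  refine (show F.dataLaw = _ from h).trans ?_
  congr 1
  ext1 i
  rw [map_gaussianReal_prod, Real.coe_toNNReal _ (sq_nonneg _), Real.coe_toNNReal _ (sq_nonneg _),
    Real.coe_toNNReal _ (sq_nonneg _)]

theorem Model.dataLaw_opt (F : Model) : F.opt.dataLaw = F.dataLaw := by
  rw [F.dataLaw_eq, InverseProblem.dataLaw]
  congr 1
  ext1 i
  congr 2
  simp only [InverseProblem.dataVar, Model.opt]
  ring

theorem Model.dataLaw_std (F : Model) : F.std.dataLaw = F.dataLaw := by
  rw [F.dataLaw_eq, InverseProblem.dataLaw]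
  congr 1
  ext1 i
  congr 2
  simp only [InverseProblem.dataVar, Model.std]
  ring

end DiagonalFiltering

theorem mainTheorem12 (F : DiagonalFiltering.Model)
    (hp : ∀ i, F.p i ≠ 0) (hq : ∀ i, F.q i ≠ 0) (hr : ∀ i, F.r i ≠ 0) :
    (∀ᵐ y ∂F.dataLaw,
      ((F.opt.posterior y ≪ F.opt.prior ∧
          DiagonalFiltering.rho (F.opt.posterior y) F.opt.prior < ∞) ↔
        Summable fun i => F.h i ^ 2 * F.m i ^ 2 * F.p i ^ 2 /
          (F.h i ^ 2 * F.q i ^ 2 + F.r i ^ 2)) ∧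
      (F.opt.posterior y ≪ F.opt.prior ↔
        Summable fun i => F.h i ^ 2 * F.m i ^ 2 * F.p i ^ 2 /
          (F.h i ^ 2 * F.q i ^ 2 + F.r i ^ 2))) ∧
    (∀ᵐ y ∂F.dataLaw,
      ((F.std.posterior y ≪ F.std.prior ∧
          DiagonalFiltering.rho (F.std.posterior y) F.std.prior < ∞) ↔
        ((Summable fun i => F.h i ^ 2 * F.m i ^ 2 * F.p i ^ 2 / F.r i ^ 2) ∧
          Summable fun i => F.h i ^ 2 * F.q i ^ 2 / F.r i ^ 2)) ∧
      (F.std.posterior y ≪ F.std.prior ↔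
        ((Summable fun i => F.h i ^ 2 * F.m i ^ 2 * F.p i ^ 2 / F.r i ^ 2) ∧
          Summable fun i => F.h i ^ 2 * F.q i ^ 2 / F.r i ^ 2))) := by
  have hp2 : ∀ i, 0 < F.p i ^ 2 := fun i => sq_pos_of_ne_zero (hp i)
  have hq2 : ∀ i, 0 < F.q i ^ 2 := fun i => sq_pos_of_ne_zero (hq i)
  have hr2 : ∀ i, 0 < F.r i ^ 2 := fun i => sq_pos_of_ne_zero (hr i)
  constructor
  · have e : (fun i => F.h i ^ 2 * F.m i ^ 2 * F.p i ^ 2 / (F.h i ^ 2 * F.q i ^ 2 + F.r i ^ 2))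
        = F.opt.snr := by
      ext i
      simp only [DiagonalFiltering.InverseProblem.snr, DiagonalFiltering.Model.opt]
      congr 1 <;> ring
    rw [e, ← F.dataLaw_opt]
    refine DiagonalFiltering.InverseProblem.ae_absolutelyContinuous_iff (fun i => ?_) hp2
    have h : F.opt.noiseVar i = F.h i ^ 2 * F.q i ^ 2 + F.r i ^ 2 := by
      simp only [DiagonalFiltering.Model.opt]
      ring
    have := hr2 i
    rw [h]
    positivity
  · have e : ((Summable fun i => F.h i ^ 2 * F.m i ^ 2 * F.p i ^ 2 / F.r i ^ 2) ∧
          Summable fun i => F.h i ^ 2 * F.q i ^ 2 / F.r i ^ 2)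
        ↔ Summable F.std.snr := by
      have e' : F.std.snr
          = fun i => F.h i ^ 2 * F.m i ^ 2 * F.p i ^ 2 / F.r i ^ 2
            + F.h i ^ 2 * F.q i ^ 2 / F.r i ^ 2 := by
        ext i
        simp only [DiagonalFiltering.InverseProblem.snr, DiagonalFiltering.Model.std]
        ring
      rw [e']
      refine ⟨fun h => h.1.add h.2, fun h => ⟨?_, ?_⟩⟩
      · exact h.of_nonneg_of_le (fun i => by positivity)
          fun i => le_add_of_nonneg_right (by positivity)
      · exact h.of_nonneg_of_le (fun i => by positivity)
          fun i => le_add_of_nonneg_left (by positivity)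
    rw [← F.dataLaw_std]
    simp_rw [e]
    refine DiagonalFiltering.InverseProblem.ae_absolutelyContinuous_iff hr2 fun i => ?_
    have h : F.std.priorVar i = F.m i ^ 2 * F.p i ^ 2 + F.q i ^ 2 := by
      simp only [DiagonalFiltering.Model.std]
      ring
    have := hq2 i
    rw [h]
    positivity
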